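/- Let $\mathbf{H}$ be an algebraic torus defined over $\mathbb{Q}$, and let $X(\mathbf{H})$ be its group of characters, i.e. of morphisms of algebraic groups $\chi:\mathbf{H}_{\overline{\mathbb{Q}}}\to\mathbb{G}_m$ over $\overline{\mathbb{Q}}$. Let $L\subset\overline{\mathbb{Q}}$ be the splitting field of $\mathbf{H}$, i.e. the smallest Galois extension of $\mathbb{Q}$ such that $\mathrm{Gal}(\overline{\mathbb{Q}}/L)$ acts trivially on $X(\mathbf{H})$; it is a number field, and $\chi(h)\in L^*$ for all $\chi\in X(\mathbf{H})$ and $h\in\mathbf{H}(\mathbb{Q})$. Let $\mathcal{O}$ be the ring of integers of $L$; for a nonzero prime ideal $\pi$ of $\mathcal{O}$, let $\mathcal{O}_\pi$ and $L_\pi$ be the $\pi$-adic completions of $\mathcal{O}$ and $L$. For $x,y\in L$, write $x\equiv y \bmod n\mathcal{O}_\pi$ if $x-y\in n\mathcal{O}_\pi$ in $L_\pi$. Let $n>0$ be an integer and let $S$ be the set of nonzero prime ideals of $\mathcal{O}$ dividing $n$. Then there exists a rational point $h\in\mathbf{H}(\mathbb{Q})$ such that (i) $\chi(h)$ is not an algebraic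 integer, for every nontrivial $\chi\in X(\mathbf{H})$, and (ii) $\chi(h)\equiv 1 \bmod n\mathcal{O}_\pi$ for every $\chi\in X(\mathbf{H})$ and every $\pi\in S$. -/

import Mathlib

open scoped TensorProduct NumberField

noncomputable section

namespace AlgTorus

/-- A fixed algebraic closure of `ℚ`. -/
abbrev Qbar : Type := AlgebraicClosure ℚ

/-- The absolute Galois group of `ℚ`. -/
abbrev AbsGal : Type := Qbar ≃ₐ[ℚ] Qbar

instance : Algebra.IsAlgebraic ℚ Qbar := AlgebraicClosure.isAlgebraic ℚ

instance : IsAlgClosure ℚ Qbar := ⟨inferInstance, inferInstance⟩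

instance : IsGalois ℚ Qbar where

/-- An affine group scheme over `ℚ` is given by its coordinate ring, a commutative Hopf algebra `H`
over `ℚ`. It is an algebraic torus if, over the algebraic closure of `ℚ`, it becomes isomorphic to
`𝔾ₘ ^ r` for some `r`; the coordinate Hopf algebra of `𝔾ₘ ^ r` is the group algebra of `ℤ ^ r`. -/
class IsAlgTorus (H : Type*) [CommRing H] [HopfAlgebra ℚ H] : Prop where
  exists_bialgEquiv : ∃ r : ℕ,
    Nonempty ((Qbar ⊗[ℚ] H) ≃ₐc[Qbar] AddMonoidAlgebra Qbar (Fin r → ℤ))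

section
variable (H : Type*) [CommRing H] [HopfAlgebra ℚ H]

/-- The rational points of the group scheme with coordinate ring `H`. -/
abbrev RationalPoint : Type _ := H →ₐ[ℚ] ℚ

/-- The characters, i.e. the morphisms of group schemes over `Qbar` from the base change of the
group to `𝔾ₘ`; on coordinate rings they are bialgebra morphisms from `Qbar[T, T⁻¹]`. -/
abbrev Character : Type _ := LaurentPolynomial Qbar →ₐc[Qbar] (Qbar ⊗[ℚ] H)

/-- The trivial character, which factors through the trivial group scheme. -/
def trivialCharacter : Character H :=
  (Bialgebra.unitBialgHom Qbar (Qbar ⊗[ℚ] H)).comp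
    (Bialgebra.counitBialgHom Qbar (LaurentPolynomial Qbar))

/-- The Galois group acts on `Qbar ⊗ H` through the left factor. -/
def galMap (σ : AbsGal) : (Qbar ⊗[ℚ] H) →ₐ[ℚ] (Qbar ⊗[ℚ] H) :=
  Algebra.TensorProduct.map (σ : Qbar →ₐ[ℚ] Qbar) (AlgHom.id ℚ H)

variable {H}

/-- The Galois action on characters is `σ • χ = (σ ⊗ id) ∘ χ ∘ σ⁻¹`, where the last `σ⁻¹` acts on
the coefficients of Laurent polynomials. This says that `σ • χ = χ`. -/
def Fixes (σ : AbsGal) (χ : Character H) : Prop :=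
  ∀ f : LaurentPolynomial Qbar,
    galMap H σ (χ f) = χ (AddMonoidAlgebra.mapRingHom ℤ (σ : Qbar →+* Qbar) f)

variable (H) in
/-- The Galois extensions `M` of `ℚ` inside `Qbar` such that the absolute Galois group of `M` acts
trivially on the group of characters. -/
def trivializingFields : Set (IntermediateField ℚ Qbar) :=
  {M | IsGalois ℚ M ∧ ∀ σ ∈ M.fixingSubgroup, ∀ χ : Character H, Fixes σ χ}

variable (H) in
/-- The splitting field: the smallest Galois extension of `ℚ` inside `Qbar` whose absolute Galois
group acts trivially on the group of characters (see `isLeast_splittingField`). -/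
def splittingField : IntermediateField ℚ Qbar := sInf (trivializingFields H)

/-- A rational point, seen as a `Qbar`-point of the base change. -/
def pointBaseChange (h : RationalPoint H) : (Qbar ⊗[ℚ] H) →ₐ[Qbar] Qbar :=
  Algebra.TensorProduct.lift (AlgHom.id Qbar Qbar) ((Algebra.ofId ℚ Qbar).comp h)
    fun _ _ => Commute.all _ _

/-- The value `χ(h)` in `Qbar`: the coordinate of the point `χ(h)` of `𝔾ₘ`. -/
def evalQbar (χ : Character H) (h : RationalPoint H) : Qbar :=
  pointBaseChange h (χ (LaurentPolynomial.T 1))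

lemma pointBaseChange_galMap (h : RationalPoint H) (σ : AbsGal) (x : Qbar ⊗[ℚ] H) :
    pointBaseChange h (galMap H σ x) = σ (pointBaseChange h x) := by
  induction x with
  | zero => simp
  | add x y hx hy => simp [hx, hy]
  | tmul a b => simp [pointBaseChange, galMap]

lemma galMap_T {σ : AbsGal} {χ : Character H} (h : Fixes σ χ) :
    galMap H σ (χ (LaurentPolynomial.T 1)) = χ (LaurentPolynomial.T 1) := by
  have h1 : AddMonoidAlgebra.mapRingHom ℤ (σ : Qbar →+* Qbar) (LaurentPolynomial.T 1) =
      LaurentPolynomial.T 1 := by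
    unfold LaurentPolynomial.T
    rw [AddMonoidAlgebra.mapRingHom_single, map_one]
  rw [h, h1]

lemma galMap_mul (σ τ : AbsGal) (x : Qbar ⊗[ℚ] H) :
    galMap H (σ * τ) x = galMap H σ (galMap H τ x) := by
  induction x with
  | zero => simp
  | add x y hx hy => simp [hx, hy]
  | tmul a b => simp [galMap]

lemma galMap_one (x : Qbar ⊗[ℚ] H) : galMap H 1 x = x := by
  induction x with
  | zero => simp
  | add x y hx hy => simp [hx, hy]
  | tmul a b => simp [galMap]

lemma evalQbar_mem (χ : Character H) (h : RationalPoint H) :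
    evalQbar χ h ∈ splittingField H := by
  simp only [splittingField, IntermediateField.mem_sInf]
  rintro M ⟨-, hM⟩
  rw [← InfiniteGalois.fixedField_fixingSubgroup M, IntermediateField.mem_fixedField_iff]
  intro σ hσ
  rw [evalQbar, ← pointBaseChange_galMap, galMap_T (hM σ hσ χ)]

/-- The value `χ(h)`, an element of the splitting field. -/
def eval (χ : Character H) (h : RationalPoint H) : splittingField H :=
  ⟨evalQbar χ h, evalQbar_mem χ h⟩

/-- Every element of `Qbar ⊗ H` is fixed by the absolute Galois group of a number field. -/
lemma exists_finite_fix (x : Qbar ⊗[ℚ] H) : ∃ M : IntermediateField ℚ Qbar,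
    FiniteDimensional ℚ M ∧ ∀ σ ∈ M.fixingSubgroup, galMap H σ x = x := by
  induction x with
  | zero => exact ⟨⊥, inferInstance, by simp⟩
  | add x y hx hy =>
    obtain ⟨M, hM, h1⟩ := hx
    obtain ⟨N, hN, h2⟩ := hy
    refine ⟨M ⊔ N, IntermediateField.finiteDimensional_sup M N, fun σ hσ => ?_⟩
    rw [map_add, h1 σ (IntermediateField.fixingSubgroup_le le_sup_left hσ),
      h2 σ (IntermediateField.fixingSubgroup_le le_sup_right hσ)]
  | tmul a b =>
    refine ⟨IntermediateField.adjoin ℚ {a}, IntermediateField.adjoin.finiteDimensional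
      (Algebra.IsIntegral.isIntegral a), fun σ hσ => ?_⟩
    have : σ a = a := (IntermediateField.mem_fixingSubgroup_iff _ σ).1 hσ a
      (IntermediateField.mem_adjoin_simple_self ℚ a)
    simp [galMap, this]

lemma fixes_of_T {σ : AbsGal} {χ : Character H}
    (h : galMap H σ (χ (LaurentPolynomial.T 1)) = χ (LaurentPolynomial.T 1)) : Fixes σ χ := by
  have key : ((galMap H σ : _ →+* _).comp (χ : LaurentPolynomial Qbar →+* (Qbar ⊗[ℚ] H))) =
      (χ : LaurentPolynomial Qbar →+* (Qbar ⊗[ℚ] H)).comp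
        (AddMonoidAlgebra.mapRingHom ℤ (σ : Qbar →+* Qbar)) := by
    apply AddMonoidAlgebra.ringHom_ext'
    · ext a
      have h1 : χ (algebraMap Qbar (LaurentPolynomial Qbar) a) = a ⊗ₜ 1 :=
        AlgHomClass.commutes χ a
      have h2 : χ (algebraMap Qbar (LaurentPolynomial Qbar) (σ a)) = (σ a) ⊗ₜ 1 :=
        AlgHomClass.commutes χ (σ a)
      change galMap H σ (χ (algebraMap Qbar (LaurentPolynomial Qbar) a)) =
        χ (AddMonoidAlgebra.mapRingHom ℤ (σ : Qbar →+* Qbar) (AddMonoidAlgebra.single 0 a))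
      rw [AddMonoidAlgebra.mapRingHom_single, h1]
      refine Eq.trans ?_ h2.symm
      simp [galMap]
    · apply MonoidHom.ext_mint
      change galMap H σ (χ (LaurentPolynomial.T 1)) =
        χ (AddMonoidAlgebra.mapRingHom ℤ (σ : Qbar →+* Qbar) (AddMonoidAlgebra.single 1 1))
      rw [AddMonoidAlgebra.mapRingHom_single, map_one]
      exact h
  intro f
  exact congrArg (fun g => g f) key

variable (H) in
lemma exists_finite_trivializing [IsAlgTorus H] : ∃ M : IntermediateField ℚ Qbar,
    FiniteDimensional ℚ M ∧ M ∈ trivializingFields H := by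
  obtain ⟨r, ⟨e⟩⟩ := IsAlgTorus.exists_bialgEquiv (H := H)
  let g : (Fin r → ℤ) → Qbar ⊗[ℚ] H := fun m => e.symm (AddMonoidAlgebra.single m 1)
  have g_zero : g 0 = 1 := map_one e.symm
  have g_add : ∀ a b, g (a + b) = g a * g b := fun a b => by
    simp only [g, ← map_mul, AddMonoidAlgebra.single_mul_single, mul_one]
  choose M hM hfix using fun i : Fin r => exists_finite_fix (g (Pi.single i 1))
  have hfin : FiniteDimensional ℚ (⨆ i, M i : IntermediateField ℚ Qbar) :=
    IntermediateField.finiteDimensional_iSup_of_finite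
  refine ⟨IntermediateField.normalClosure ℚ (⨆ i, M i : IntermediateField ℚ Qbar) Qbar,
    inferInstance, @IsGalois.mk _ _ _ _ _ _ (normalClosure.normal _ _ _), fun σ hσ χ => ?_⟩
  replace hσ := IntermediateField.fixingSubgroup_le
    (IntermediateField.le_normalClosure (⨆ i, M i : IntermediateField ℚ Qbar)) hσ
  apply fixes_of_T
  have hgen : ∀ i, galMap H σ (g (Pi.single i 1)) = g (Pi.single i 1) := fun i =>
    hfix i σ (IntermediateField.fixingSubgroup_le (le_iSup M i) hσ)
  let G : AddSubgroup (Fin r → ℤ) :=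
    { carrier := {m | galMap H σ (g m) = g m}
      zero_mem' := by simp [g_zero]
      add_mem' := fun {a b} (ha : _ = _) (hb : _ = _) => by
        simp only [Set.mem_ofPred_eq, g_add, map_mul, ha, hb]
      neg_mem' := fun {a} (ha : _ = _) => by
        have h1 : g (-a) * g a = 1 := by rw [← g_add, neg_add_cancel, g_zero]
        have h2 : galMap H σ (g (-a)) * g a = 1 := by
          conv_lhs => rw [← ha]
          rw [← map_mul, h1, map_one]
        exact left_inv_eq_right_inv h2 ((mul_comm _ _).trans h1) }
  have hall : ∀ m, galMap H σ (g m) = g m := fun m => by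
    have : m = ∑ i, m i • (Pi.single i 1 : Fin r → ℤ) := by
      ext j
      simp [Finset.sum_apply, Pi.single_apply]
    change m ∈ G
    rw [this]
    exact sum_mem fun i _ => zsmul_mem (hgen i) _
  have hT : IsGroupLikeElem Qbar (LaurentPolynomial.T 1 : LaurentPolynomial Qbar) :=
    AddMonoidAlgebra.isGroupLikeElem_single_one 1
  obtain ⟨m, hm⟩ := AddMonoidAlgebra.isGroupLikeElem_iff_mem_range_single_one.1
    ((hT.map χ).map e)
  have : χ (LaurentPolynomial.T 1) = g m := by
    simp only [g, hm]
    exact (e.symm_apply_apply _).symm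
  rw [this, hall]

variable (H) in
lemma splittingField_fixes [IsAlgTorus H] (σ : AbsGal) (hσ : σ ∈ (splittingField H).fixingSubgroup)
    (χ : Character H) : Fixes σ χ := by
  obtain ⟨M, _, hM⟩ := exists_finite_trivializing H
  let K : Subgroup AbsGal :=
    { carrier := {τ | ∀ χ : Character H,
        galMap H τ (χ (LaurentPolynomial.T 1)) = χ (LaurentPolynomial.T 1)}
      one_mem' := fun χ => galMap_one _
      mul_mem' := fun {a b} ha hb χ => by rw [galMap_mul, hb χ, ha χ]
      inv_mem' := fun {a} ha χ => by
        conv_lhs => rw [← ha χ]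
        rw [← galMap_mul, inv_mul_cancel, galMap_one] }
  have hMK : M.fixingSubgroup ≤ K := fun τ hτ χ => galMap_T (hM.2 τ hτ χ)
  have hK : IsClosed (K : Set AbsGal) := K.isClosed_of_isOpen
    (Subgroup.isOpen_mono hMK M.fixingSubgroup_isOpen)
  have hle : IntermediateField.fixedField K ≤ splittingField H := by
    refine le_sInf fun N hN => ?_
    have := hN.1
    rw [← InfiniteGalois.fixedField_fixingSubgroup N]
    exact IntermediateField.fixedField_antitone (fun τ hτ χ => galMap_T (hN.2 τ hτ χ))
  have h1 := IntermediateField.fixingSubgroup_le hle hσ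
  rw [InfiniteGalois.fixingSubgroup_fixedField ⟨K, hK⟩] at h1
  exact fixes_of_T (h1 χ)

variable (H) in
/-- The splitting field really is the smallest field with the defining property. -/
theorem isLeast_splittingField [IsAlgTorus H] :
    IsLeast (trivializingFields H) (splittingField H) := by
  refine ⟨⟨?_, splittingField_fixes H⟩, fun M hM => sInf_le hM⟩
  obtain ⟨M, -, hM⟩ := exists_finite_trivializing H
  have : Nonempty (trivializingFields H) := ⟨⟨M, hM⟩⟩
  have : Normal ℚ (splittingField H) := by
    rw [splittingField, sInf_eq_iInf']
    exact IntermediateField.normal_iInf ℚ Qbar (h := fun M => M.2.1.to_normal)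
  exact {}

instance numberField_splittingField [IsAlgTorus H] : NumberField (splittingField H) := by
  obtain ⟨M, hM, hM'⟩ := exists_finite_trivializing H
  have h : splittingField H ≤ M := sInf_le hM'
  have h1 : FiniteDimensional ℚ (splittingField H) :=
    FiniteDimensional.of_injective (IntermediateField.inclusion h).toLinearMap
      (IntermediateField.inclusion_injective h)
  refine { to_charZero := inferInstance, to_finiteDimensional := ?_ }
  convert! h1

end

section
variable {L : Type*} [Field L] [NumberField L]

/-- The set of primes of `L` dividing the integer `n`. -/
def primeDivisors (L : Type*) [Field L] [NumberField L] (n : ℕ) :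
    Set (IsDedekindDomain.HeightOneSpectrum (𝓞 L)) :=
  {π | π.asIdeal ∣ Ideal.span {(n : 𝓞 L)}}

/-- The congruence `x ≡ y` modulo `n 𝓞_π`, in the `π`-adic completion of `L`. -/
def CongrMod (n : ℕ) (π : IsDedekindDomain.HeightOneSpectrum (𝓞 L)) (x y : L) : Prop :=
  ∃ z ∈ π.adicCompletionIntegers L,
    algebraMap L (π.adicCompletion L) x - algebraMap L (π.adicCompletion L) y =
      (n : π.adicCompletion L) * z

end

end AlgTorus

end

/-! A torus is governed by its character lattice `ℤ ^ r` with the action of `Γ = Gal(L/ℚ)`, and a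
rational point `h` amounts to a `Γ`-equivariant homomorphism `χ ↦ χ(h)` from that lattice to `Lˣ`.
It therefore suffices to build an equivariant `p` with the required values.

For any `w i` in `Lˣ`, the product of `s (w i) ^ (s⁻¹ m) i` over all `s` in `Γ` and all `i` is
equivariant in `m`. Take `w i = a (2i) / a (2i+1)`, where the algebraic integers `a k ≡ 1 mod n`
come with primes `P k` that contain `s (a j)` only when `j = k` and `s = 1`
(`exists_seq_mem_prime_iff`). The orders of `p m` at `P (2i)` and `P (2i+1)` are then positive
multiples of `m i` and `-m i`, so `m i ≠ 0` forces a pole at one of them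
(`exists_equivariant_hom_not_isIntegral`).

To return to the torus, characters are identified with group-like elements of `Qbar ⊗ H`, and the
Galois-equivariant `Qbar`-point defined by `p` descends to `ℚ` (`exists_pointBaseChange_eq`). -/

noncomputable section

namespace AlgTorus
-- Algebraic integers separated from their conjugates by primes
section
variable {L : Type*} [Field L] [NumberField L]

open IsDedekindDomain

/-- The norm of `1 - t γ` is a nonconstant polynomial in `t`, so it takes the values `0, ±1` only
finitely often. -/
lemma exists_one_sub_nat_mul_not_isUnit {γ : 𝓞 L} (hγ : γ ≠ 0) :
    ∃ t : ℕ, 1 - t * γ ≠ 0 ∧ ¬ IsUnit (1 - t * γ) := by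
  classical
  let p : Polynomial Qbar := ∏ σ : L →ₐ[ℚ] Qbar, (1 - Polynomial.C (σ γ) * Polynomial.X)
  have hne : ∀ σ : L →ₐ[ℚ] Qbar, σ γ ≠ 0 := fun σ h =>
    hγ (NumberField.RingOfIntegers.coe_eq_zero_iff.1 ((map_eq_zero σ).1 h))
  have hfac : ∀ σ : L →ₐ[ℚ] Qbar,
      (1 - Polynomial.C (σ γ) * Polynomial.X : Polynomial Qbar).natDegree = 1 := fun σ => by
    rw [← Polynomial.natDegree_neg, neg_sub, ← Polynomial.C_1, Polynomial.natDegree_sub_C,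
      Polynomial.natDegree_C_mul_X _ (hne σ)]
  have hfac0 : ∀ σ : L →ₐ[ℚ] Qbar,
      (1 - Polynomial.C (σ γ) * Polynomial.X : Polynomial Qbar) ≠ 0 := fun σ h => by
    have := hfac σ
    simp [h] at this
  have hdeg : 0 < p.natDegree := by
    have hcard : Fintype.card (L →ₐ[ℚ] Qbar) = Module.finrank ℚ L := AlgHom.card ℚ L Qbar
    rw [Polynomial.natDegree_prod _ _ fun σ _ => hfac0 σ, Finset.sum_congr rfl fun σ _ => hfac σ]
    simp [hcard, Module.finrank_pos]
  have hp : ∀ a : Qbar, p - Polynomial.C a ≠ 0 := fun a h => by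
    rw [sub_eq_zero] at h
    simp [h] at hdeg
  let q : Polynomial Qbar :=
    (p - Polynomial.C 0) * ((p - Polynomial.C 1) * (p - Polynomial.C (-1)))
  have hq : q ≠ 0 := mul_ne_zero (hp _) (mul_ne_zero (hp _) (hp _))
  obtain ⟨_, ⟨t, rfl⟩, ht⟩ := (Set.infinite_range_of_injective
    (Nat.cast_injective (R := Qbar))).exists_notMem_finset q.roots.toFinset
  have hev : p.eval (t : Qbar) =
      algebraMap ℚ Qbar (Algebra.norm ℚ ((1 - t * γ : 𝓞 L) : L)) := by
    rw [Algebra.norm_eq_prod_embeddings, Polynomial.eval_prod]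
    refine Finset.prod_congr rfl fun σ _ => ?_
    have : ((1 - t * γ : 𝓞 L) : L) = 1 - t * γ := by simp
    rw [this, Polynomial.eval_sub, Polynomial.eval_one, Polynomial.eval_C_mul, Polynomial.eval_X,
      map_sub, map_one, map_mul, map_natCast, mul_comm]
  simp only [Multiset.mem_toFinset, Polynomial.mem_roots hq, Polynomial.IsRoot, q,
    Polynomial.eval_mul, Polynomial.eval_sub, Polynomial.eval_C, mul_eq_zero, not_or, hev] at ht
  refine ⟨t, fun h => ht.1 (by simp [h]), fun h => ?_⟩
  rw [NumberField.isUnit_iff_norm, RingOfIntegers.coe_norm] at h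
  rcases (abs_eq zero_le_one).1 h with h | h
  · exact ht.2.1 (by rw [h]; simp)
  · exact ht.2.2 (by rw [h]; simp)

lemma dvd_absNorm_span_singleton (x : 𝓞 L) : x ∣ (Ideal.absNorm (Ideal.span {x}) : 𝓞 L) :=
  Ideal.mem_span_singleton.1 (Ideal.absNorm_mem _)

lemma absNorm_span_singleton_ne_zero {x : 𝓞 L} (hx : x ≠ 0) :
    Ideal.absNorm (Ideal.span {x}) ≠ 0 := by
  simpa [Ideal.absNorm_eq_zero_iff] using hx

/-- A nonzero algebraic integer moved by every nontrivial automorphism. -/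
lemma exists_ne_zero_forall_ringEquiv_ne (L : Type*) [Field L] [NumberField L] :
    ∃ θ : 𝓞 L, θ ≠ 0 ∧ ∀ e : L ≃+* L, e θ = θ → e = 1 := by
  obtain ⟨x, hx⟩ := Field.exists_primitive_element ℚ L
  obtain ⟨m, hm, hint⟩ := ((IsFractionRing.isAlgebraic_iff ℤ ℚ L).2
    (IsAlgebraic.of_finite ℚ x)).exists_integral_multiple
  have hgen : ∀ (e : L ≃+* L), e x = x → e = 1 := fun e he => by
    ext y
    have hy : y ∈ IntermediateField.adjoin ℚ {x} := hx ▸ IntermediateField.mem_top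
    induction hy using IntermediateField.adjoin_induction with
    | mem y h => rwa [Set.mem_singleton_iff.1 h]
    | algebraMap c => simp
    | add y z _ _ h1 h2 => rw [map_add, h1, h2]; rfl
    | inv y _ h => rw [map_inv₀, h]; rfl
    | mul y z _ _ h1 h2 => rw [map_mul, h1, h2]; rfl
  have hm' : (m : L) ≠ 0 := by exact_mod_cast hm
  have key : ∀ e : L ≃+* L, e (m • x) = m • x → e = 1 := fun e he => by
    refine hgen e ?_
    rw [map_zsmul, zsmul_eq_mul, zsmul_eq_mul] at he
    exact mul_left_cancel₀ hm' he
  by_cases h0 : m • x = 0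
  -- Here the primitive element is `0`, so `key` makes every automorphism trivial and any nonzero
  -- `θ` will do.
  · refine ⟨1, one_ne_zero, fun e _ => key e (by rw [h0, map_zero])⟩
  · exact ⟨⟨m • x, hint⟩, fun h => h0 (congrArg (algebraMap (𝓞 L) L) h), key⟩

variable {Γ : Type*} [Group Γ] [Finite Γ] (φ : Γ →* (L ≃+* L))

/-- An algebraic integer congruent to `1` modulo `M`, divisible by a prime that divides none of
its other conjugates. -/
lemma exists_mem_prime_forall_conj_notMem (hφ : Function.Injective φ) {M : ℕ} (hM : M ≠ 0) :
    ∃ (a : 𝓞 L) (P : HeightOneSpectrum (𝓞 L)), a ≠ 0 ∧ (M : 𝓞 L) ∣ a - 1 ∧ a ∈ P.asIdeal ∧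
      ∀ s : Γ, s ≠ 1 → NumberField.RingOfIntegers.mapRingEquiv (φ s) a ∉ P.asIdeal := by
  classical
  have := Fintype.ofFinite Γ
  obtain ⟨θ, hθ, hmove⟩ := exists_ne_zero_forall_ringEquiv_ne L
  let δ : Γ → 𝓞 L := fun s => NumberField.RingOfIntegers.mapRingEquiv (φ s) θ - θ
  have hδ : ∀ s, s ≠ 1 → δ s ≠ 0 := fun s hs h => hs <| hφ <| by
    rw [map_one]
    exact hmove _ (congrArg (algebraMap (𝓞 L) L) (sub_eq_zero.1 h))
  -- A common multiple of all `δ s`. Since `a ≡ 1` modulo `t * M * D`, a prime containing `a`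
  -- contains neither this integer nor any `δ s`; but `a - s a = t * M * D * δ s`.
  let D : ℕ := ∏ s with s ≠ 1, Ideal.absNorm (Ideal.span {δ s})
  have hD : D ≠ 0 := Finset.prod_ne_zero_iff.2 fun s hs =>
    absNorm_span_singleton_ne_zero (hδ s (Finset.mem_filter.1 hs).2)
  have hdvd : ∀ s, s ≠ 1 → δ s ∣ (D : 𝓞 L) := fun s hs =>
    (dvd_absNorm_span_singleton _).trans
      (Nat.cast_dvd_cast (Finset.dvd_prod_of_mem _ (by simpa using hs)))
  obtain ⟨t, h0, hu⟩ := exists_one_sub_nat_mul_not_isUnit (γ := (M : 𝓞 L) * (D : 𝓞 L) * θ)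
    (mul_ne_zero (mul_ne_zero (Nat.cast_ne_zero.2 hM) (Nat.cast_ne_zero.2 hD)) hθ)
  set a : 𝓞 L := 1 - t * (M * D * θ) with ha
  obtain ⟨P, hP, haP⟩ := exists_max_ideal_of_mem_nonunits hu
  refine ⟨a, ⟨P, hP.isPrime, fun h => h0 (by simpa [h] using haP)⟩, h0,
    ⟨-(t * D * θ), by rw [ha]; ring⟩, haP, fun s hs hsP => ?_⟩
  have h1 : (1 : 𝓞 L) ∉ P := (Ideal.ne_top_iff_one P).1 hP.ne_top
  have h2 : ((t * M * D : ℕ) : 𝓞 L) * δ s ∈ P := by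
    have : ((t * M * D : ℕ) : 𝓞 L) * δ s = a - NumberField.RingOfIntegers.mapRingEquiv (φ s) a := by
      simp only [ha, δ, map_sub, map_one, map_mul, map_natCast]
      push_cast
      ring
    rw [this]
    exact sub_mem haP hsP
  have h3 : ((t * M * D : ℕ) : 𝓞 L) ∉ P := fun h => h1 <| by
    have : (1 : 𝓞 L) = a + ((t * M * D : ℕ) : 𝓞 L) * θ := by rw [ha]; push_cast; ring
    rw [this]
    exact add_mem haP (P.mul_mem_right _ h)
  refine h3 ?_
  push_cast
  exact P.mul_mem_left _ (P.mem_of_dvd (hdvd s hs) ((hP.isPrime.mem_or_mem h2).resolve_left h3))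

/-- Infinitely many pairs as in `exists_mem_prime_forall_conj_notMem`, with the primes separating
the different elements. -/
lemma exists_seq_mem_prime_iff (hφ : Function.Injective φ) {n : ℕ} (hn : n ≠ 0) :
    ∃ (a : ℕ → 𝓞 L) (P : ℕ → HeightOneSpectrum (𝓞 L)), (∀ i, a i ≠ 0) ∧
      (∀ i, (n : 𝓞 L) ∣ a i - 1) ∧
      ∀ i j s, NumberField.RingOfIntegers.mapRingEquiv (φ s) (a i) ∈ (P j).asIdeal ↔ i = j ∧ s = 1 := by
  classical
  let r : 𝓞 L × HeightOneSpectrum (𝓞 L) → 𝓞 L × HeightOneSpectrum (𝓞 L) → Prop := fun x y =>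
    ∀ s, NumberField.RingOfIntegers.mapRingEquiv (φ s) x.1 ∉ y.2.asIdeal ∧
      NumberField.RingOfIntegers.mapRingEquiv (φ s) y.1 ∉ x.2.asIdeal
  have : Std.Symm r := ⟨fun x y h s => (h s).symm⟩
  obtain ⟨f, hf, hr⟩ := exists_seq_of_forall_finset_exists'
    (fun x : 𝓞 L × HeightOneSpectrum (𝓞 L) => x.1 ≠ 0 ∧ (n : 𝓞 L) ∣ x.1 - 1 ∧
      x.1 ∈ x.2.asIdeal ∧ ∀ s, s ≠ 1 → NumberField.RingOfIntegers.mapRingEquiv (φ s) x.1 ∉ x.2.asIdeal) r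
    (fun S hS => by
      let N : 𝓞 L × HeightOneSpectrum (𝓞 L) → ℕ := fun x => Ideal.absNorm (Ideal.span {x.1})
      have hN : ∏ x ∈ S, N x ≠ 0 := Finset.prod_ne_zero_iff.2 fun x hx =>
        absNorm_span_singleton_ne_zero (hS x hx).1
      -- Being `1` modulo the norms of all earlier elements separates in both directions: the new
      -- prime contains no conjugate of an old element, and the conjugates of `a` stay `1` modulo
      -- each old prime.
      obtain ⟨a, P, h0, hdvd, haP, hsP⟩ := exists_mem_prime_forall_conj_notMem φ hφ
        (mul_ne_zero hn hN)
      refine ⟨(a, P), ⟨h0, dvd_trans (by simp) hdvd, haP, hsP⟩, fun x hx s => ?_⟩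
      have hNx : (N x : 𝓞 L) ∣ a - 1 :=
        (Nat.cast_dvd_cast ((Finset.dvd_prod_of_mem N hx).mul_left n)).trans hdvd
      have key : ∀ (Q : HeightOneSpectrum (𝓞 L)) (b : 𝓞 L), (N x : 𝓞 L) ∣ b - 1 →
          (N x : 𝓞 L) ∈ Q.asIdeal → b ∉ Q.asIdeal := fun Q b hb hNQ hbQ => by
        refine (Ideal.ne_top_iff_one _).1 Q.isPrime.ne_top ?_
        have := sub_mem hbQ (Q.asIdeal.mem_of_dvd hb hNQ)
        rwa [sub_sub_cancel] at this
      constructor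
      · intro hmem
        refine key P a hNx (P.asIdeal.mem_of_dvd ?_ hmem) haP
        have := map_dvd (NumberField.RingOfIntegers.mapRingEquiv (φ s)) (dvd_absNorm_span_singleton x.1)
        rwa [map_natCast] at this
      · refine key x.2 _ ?_ (x.2.asIdeal.mem_of_dvd (dvd_absNorm_span_singleton x.1)
          (hS x hx).2.2.1)
        have := map_dvd (NumberField.RingOfIntegers.mapRingEquiv (φ s)) hNx
        rwa [map_natCast, map_sub, map_one] at this)
  refine ⟨fun i => (f i).1, fun i => (f i).2, fun i => (hf i).1, fun i => (hf i).2.1,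
    fun i j s => ⟨fun h => ?_, ?_⟩⟩
  · have hij : i = j := by
      by_contra hij
      exact (hr hij s).1 h
    subst hij
    exact ⟨rfl, by_contra fun hs => (hf i).2.2.2 s hs h⟩
  · rintro ⟨rfl, rfl⟩
    have : NumberField.RingOfIntegers.mapRingEquiv (φ 1) (f i).1 = (f i).1 := by
      ext
      simp
    rw [this]
    exact (hf i).2.2.1

/-! ### Congruences modulo `n` as a multiplicative subgroup -/

/-- The elements of `Lˣ` that are congruent to `1` modulo `n` at a prime dividing `n`. -/
def congrOneSubgroup {n : ℕ} {π : HeightOneSpectrum (𝓞 L)} (hπ : π ∈ primeDivisors L n) :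
    Subgroup Lˣ where
  carrier := {u | π.valuation L (u - 1) ≤ π.valuation L (n : L)}
  one_mem' := by simp
  mul_mem' {u w} hu hw := by
    have hle : π.valuation L (n : L) ≤ 1 := by
      simpa using π.valuation_le_one (K := L) (n : 𝓞 L)
    have hu1 : π.valuation L (u : L) ≤ 1 := by
      have : (u : L) = (u - 1) + 1 := by ring
      rw [this]
      exact (Valuation.map_add _ _ _).trans (max_le (le_trans hu hle) (by simp))
    have : ((u * w : Lˣ) : L) - 1 = u * (w - 1) + (u - 1) := by push_cast; ring
    change π.valuation L (((u * w : Lˣ) : L) - 1) ≤ _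
    rw [this]
    refine (Valuation.map_add _ _ _).trans (max_le ?_ hu)
    rw [map_mul]
    exact (mul_le_of_le_one_left' hu1).trans hw
  inv_mem' {u} hu := by
    -- Closure under inverses is where `π ∣ n` is needed: it forces `u` to be a unit at `π`.
    have hlt : π.valuation L (n : L) < 1 := by
      have := (π.valuation_lt_one_iff_mem (K := L) (n : 𝓞 L)).2
        (Ideal.dvd_span_singleton.1 hπ)
      simpa using this
    have hu1 : π.valuation L (u : L) = 1 := by
      have : (u : L) = 1 + (u - 1) := by ring
      rw [this]
      exact Valuation.map_one_add_of_lt _ (lt_of_le_of_lt hu hlt)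
    have : ((u⁻¹ : Lˣ) : L) - 1 = -((u : L)⁻¹ * (u - 1)) := by
      rw [Units.val_inv_eq_inv_val]
      have := u.ne_zero
      field_simp
      ring
    change π.valuation L (((u⁻¹ : Lˣ) : L) - 1) ≤ _
    rw [this, Valuation.map_neg, map_mul, map_inv₀, hu1, inv_one, one_mul]
    exact hu

/-- The valuation bound makes `(u - 1) / n` a `π`-adic integer, which is the witness. -/
lemma congrMod_one_of_mem {n : ℕ} (hn : n ≠ 0) {π : HeightOneSpectrum (𝓞 L)}
    (hπ : π ∈ primeDivisors L n) {u : Lˣ} (hu : u ∈ congrOneSubgroup hπ) :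
    CongrMod n π (u : L) 1 := by
  have hn' : (n : L) ≠ 0 := Nat.cast_ne_zero.2 hn
  refine ⟨algebraMap L (π.adicCompletion L) ((u - 1) / n), ?_, ?_⟩
  · rw [HeightOneSpectrum.mem_adicCompletionIntegers]
    have h1 := HeightOneSpectrum.valuedAdicCompletion_eq_valuation' π (((u : L) - 1) / n)
    refine h1.le.trans ?_
    rw [map_div₀]
    exact div_le_one_of_le₀ hu zero_le
  · rw [← map_sub, ← map_natCast (algebraMap L (π.adicCompletion L)), ← map_mul,
      mul_div_cancel₀ _ hn']

lemma mem_congrOneSubgroup {n : ℕ} {π : HeightOneSpectrum (𝓞 L)}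
    (hπ : π ∈ primeDivisors L n) {u : Lˣ} {a : 𝓞 L} (ha : (n : 𝓞 L) ∣ a - 1) (hu : (u : L) = a) :
    u ∈ congrOneSubgroup hπ := by
  obtain ⟨c, hc⟩ := ha
  have : (u : L) - 1 = n * (c : L) := by
    rw [hu]
    simpa using congrArg (algebraMap (𝓞 L) L) hc
  change π.valuation L ((u : L) - 1) ≤ _
  rw [this, map_mul]
  exact mul_le_of_le_one_right' (π.valuation_le_one c)

/-! ### The equivariant homomorphism -/

/-- For a finite group acting faithfully on a number field `L` and acting on `ℤ ^ r`, there is an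
equivariant homomorphism `ℤ ^ r → Lˣ` that takes no integral value outside `0` and only values
congruent to `1` modulo `n`. -/
theorem exists_equivariant_hom_not_isIntegral (hφ : Function.Injective φ) {r : ℕ}
    (ρ : Γ →* AddMonoid.End (Fin r → ℤ)) {n : ℕ} (hn : n ≠ 0) :
    ∃ h : Multiplicative (Fin r → ℤ) →* L,
      (∀ s m, h (.ofAdd (ρ s m)) = φ s (h (.ofAdd m))) ∧
      (∀ m, m ≠ 0 → ¬ IsIntegral ℤ (h (.ofAdd m))) ∧
      ∀ m, ∀ π ∈ primeDivisors L n, CongrMod n π (h (.ofAdd m)) 1 := by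
  classical
  have := Fintype.ofFinite Γ
  obtain ⟨a, P, ha0, hdvd, hmem⟩ := exists_seq_mem_prime_iff φ hφ hn
  have ha0' : ∀ k, (a k : L) ≠ 0 := fun k => by simpa using ha0 k
  let u : ℕ → Lˣ := fun k => Units.mk0 (a k : L) (ha0' k)
  let U : Γ → Fin r → Lˣ := fun s i =>
    Units.map (φ s : L →* L) (u (2 * i) / u (2 * i + 1))
  let H : Multiplicative (Fin r → ℤ) →* Lˣ :=
    { toFun := fun m => ∏ s, ∏ i, U s i ^ (ρ s⁻¹ m.toAdd i)
      map_one' := by simp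
      map_mul' := fun m m' => by
        simp [zpow_add, Finset.prod_mul_distrib] }
  have hH : ∀ m, H (.ofAdd m) = ∏ s, ∏ i, U s i ^ (ρ s⁻¹ m i) := fun m => rfl
  refine ⟨(Units.coeHom L).comp H, fun s m => ?_, fun m hm hint => ?_, fun m π hπ => ?_⟩
  -- Equivariance: `s` permutes the factors of the product over the group, by `t ↦ s * t`.
  · have hU : ∀ t i, Units.map (φ s : L →* L) (U t i) = U (s * t) i := fun t i => by
      ext
      simp [U]
    have : H (.ofAdd (ρ s m)) = Units.map (φ s : L →* L) (H (.ofAdd m)) := by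
      rw [hH, hH, map_prod, ← Equiv.prod_comp (Equiv.mulLeft s)]
      refine Finset.prod_congr rfl fun t _ => ?_
      rw [map_prod]
      refine Finset.prod_congr rfl fun i _ => ?_
      have h1 : ρ (s * t)⁻¹ (ρ s m) = ρ t⁻¹ m := by
        have h2 : ρ t⁻¹ = ρ (s * t)⁻¹ * ρ s := by
          rw [← map_mul]
          congr 1
          group
        rw [h2]
        rfl
      rw [map_zpow, hU, Equiv.coe_mulLeft, h1]
    exact congrArg Units.val this
  · obtain ⟨i, hi⟩ := Function.ne_iff.1 hm
    have hv : ∀ j k s, ((P j).valuation L (φ s (a k) : L)) =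
        if k = j ∧ s = 1 then (P j).valuation L (a j) else 1 := fun j k s => by
      have h2 := (P j).valuation_le_one (K := L)
        (NumberField.RingOfIntegers.mapRingEquiv (φ s) (a k))
      have h3 := (P j).valuation_lt_one_iff_mem (K := L)
        (NumberField.RingOfIntegers.mapRingEquiv (φ s) (a k))
      rw [hmem k j s] at h3
      split_ifs with h
      · obtain ⟨rfl, rfl⟩ := h
        simp
      · exact eq_of_le_of_not_lt h2 fun h' => h (h3.1 h')
    have hlt : ∀ j, (P j).valuation L (a j) < 1 := fun j =>
      ((P j).valuation_lt_one_iff_mem (K := L) (a j)).2 <| by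
        have := (hmem j j 1).2 ⟨rfl, rfl⟩
        have h1 : NumberField.RingOfIntegers.mapRingEquiv (φ 1) (a j) = a j := by
          ext
          simp
        rwa [h1] at this
    have hpos : ∀ j, 0 < (P j).valuation L (a j) := fun j => by
      simpa [zero_lt_iff] using ha0 j
    have hU : ∀ j s i, (P j).valuation L (U s i) = (P j).valuation L (φ s (a (2 * i))) /
        (P j).valuation L (φ s (a (2 * i + 1))) := fun j s i => by
      simp [U, u]
    -- At these two primes only the factor with `s = 1` and index `i` has nontrivial valuation.
    have hprod : ∀ j, (j = 2 * i.val ∨ j = 2 * i.val + 1) →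
        (P j).valuation L (H (.ofAdd m) : L) = (P j).valuation L (U 1 i) ^ m i := fun j hj => by
      rw [hH, Units.coe_prod, map_prod, Finset.prod_eq_single 1 ?_ (by simp)]
      · rw [Units.coe_prod, map_prod, Finset.prod_eq_single i ?_ (by simp)]
        · simp
        · intro i' _ hi'
          rw [Units.val_zpow_eq_zpow_val, map_zpow₀, hU, hv, hv, if_neg, if_neg]
          · simp
          · have := Fin.val_ne_of_ne hi'
            omega
          · have := Fin.val_ne_of_ne hi'
            omega
      · intro s _ hs
        rw [Units.coe_prod, map_prod, Finset.prod_eq_one]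
        intro i' _
        rw [Units.val_zpow_eq_zpow_val, map_zpow₀, hU, hv, hv, if_neg (by tauto),
          if_neg (by tauto)]
        simp
    obtain ⟨x, hx⟩ : ∃ x : 𝓞 L, (x : L) = (H (.ofAdd m) : L) := ⟨⟨_, hint⟩, rfl⟩
    have hle : ∀ j, (P j).valuation L (H (.ofAdd m) : L) ≤ 1 := fun j => by
      rw [← hx]
      exact (P j).valuation_le_one x
    -- The numerator gives a pole at `P (2i)` when `m i < 0`, the denominator one at `P (2i+1)` when
    -- `m i > 0`.
    rcases lt_or_gt_of_ne hi with hneg | hpos'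
    · have h1 := hle (2 * i)
      rw [hprod _ (Or.inl rfl), hU, hv, hv, if_pos (by simp), if_neg (by simp), div_one] at h1
      exact absurd h1 (not_le.2 (one_lt_zpow_of_neg₀ (hpos _) (hlt _) hneg))
    · have h1 := hle (2 * i + 1)
      rw [hprod _ (Or.inr rfl), hU, hv, hv, if_neg (by simp), if_pos (by simp), one_div] at h1
      exact absurd h1 (not_le.2 (one_lt_zpow₀ ((one_lt_inv₀ (hpos _)).2 (hlt _)) hpos'))
  · refine congrMod_one_of_mem hn hπ (prod_mem fun s _ => prod_mem fun i _ => zpow_mem ?_ _)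
    have hk : ∀ k, Units.map (φ s : L →* L) (u k) ∈ congrOneSubgroup hπ := fun k => by
      refine mem_congrOneSubgroup hπ
        (a := NumberField.RingOfIntegers.mapRingEquiv (φ s) (a k)) ?_ rfl
      have := map_dvd (NumberField.RingOfIntegers.mapRingEquiv (φ s)) (hdvd k)
      rwa [map_natCast, map_sub, map_one] at this
    simp only [U, map_div]
    exact div_mem (hk _) (hk _)

end
-- Galois action on group-like elements, and descent of points
section
variable {H : Type*} [CommRing H] [HopfAlgebra ℚ H]

lemma galMap_smul (σ : AbsGal) (c : Qbar) (x : Qbar ⊗[ℚ] H) :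
    galMap H σ (c • x) = σ c • galMap H σ x := by
  induction x with
  | zero => simp
  | add x y hx hy => simp [hx, hy]
  | tmul a b => simp [galMap, TensorProduct.smul_tmul']

/-- The semilinear Galois action on `(Qbar ⊗ H) ⊗ (Qbar ⊗ H)`. -/
def galMapTensor (σ : AbsGal) :
    (Qbar ⊗[ℚ] H) ⊗[Qbar] (Qbar ⊗[ℚ] H) →+ (Qbar ⊗[ℚ] H) ⊗[Qbar] (Qbar ⊗[ℚ] H) :=
  TensorProduct.liftAddHom
    (AddMonoidHom.mk' (fun x => AddMonoidHom.mk' (fun y => galMap H σ x ⊗ₜ[Qbar] galMap H σ y)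
      fun y z => by rw [map_add, TensorProduct.tmul_add])
      fun x z => by
        ext y
        exact (congrArg (· ⊗ₜ[Qbar] _) (map_add _ _ _)).trans (TensorProduct.add_tmul _ _ _))
    fun c x y => by
      simp only [AddMonoidHom.mk'_apply, galMap_smul, TensorProduct.smul_tmul]

lemma galMapTensor_tmul (σ : AbsGal) (x y : Qbar ⊗[ℚ] H) :
    galMapTensor σ (x ⊗ₜ y) = galMap H σ x ⊗ₜ galMap H σ y := rfl

/-- The comultiplication is defined over `ℚ`, so it commutes with the action on coefficients. -/
lemma comul_galMap (σ : AbsGal) (x : Qbar ⊗[ℚ] H) :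
    Coalgebra.comul (R := Qbar) (galMap H σ x) =
      galMapTensor σ (Coalgebra.comul (R := Qbar) x) := by
  induction x with
  | zero => simp
  | add x y hx hy => simp [hx, hy]
  | tmul a b =>
    have h1 : galMap H σ (a ⊗ₜ b) = σ a ⊗ₜ b := by simp [galMap]
    rw [h1, TensorProduct.comul_tmul, TensorProduct.comul_tmul]
    simp only [CommSemiring.comul_apply]
    induction Coalgebra.comul (R := ℚ) b with
    | zero => simp
    | add x y hx hy => simp only [TensorProduct.tmul_add, map_add, hx, hy]
    | tmul c d => simp [galMapTensor_tmul, galMap]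

lemma counit_galMap (σ : AbsGal) (x : Qbar ⊗[ℚ] H) :
    Coalgebra.counit (R := Qbar) (galMap H σ x) = σ (Coalgebra.counit (R := Qbar) x) := by
  induction x with
  | zero => simp
  | add x y hx hy => simp [hx, hy]
  | tmul a b =>
    simp only [galMap, Algebra.TensorProduct.map_tmul, TensorProduct.counit_tmul,
      CommSemiring.counit_apply]
    exact (map_rat_smul (σ : Qbar →+ Qbar) _ _).symm

/-- `galMap H σ` is only semilinear over `Qbar`, so this rests on its compatibility with `comul` and
`counit`. -/
lemma isGroupLikeElem_galMap {x : Qbar ⊗[ℚ] H} (hx : IsGroupLikeElem Qbar x) (σ : AbsGal) :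
    IsGroupLikeElem Qbar (galMap H σ x) where
  counit_eq_one := by rw [counit_galMap, hx.counit_eq_one, map_one]
  comul_eq_tmul_self := by rw [comul_galMap, hx.comul_eq_tmul_self, galMapTensor_tmul]

/-- A `Qbar`-point of the base change that commutes with the Galois action comes from a rational
point. -/
lemma exists_pointBaseChange_eq (f : (Qbar ⊗[ℚ] H) →ₐ[Qbar] Qbar)
    (hf : ∀ σ x, f (galMap H σ x) = σ (f x)) :
    ∃ h : RationalPoint H, pointBaseChange h = f := by
  let g : H →ₐ[ℚ] Qbar :=
    (f.restrictScalars ℚ).comp (Algebra.TensorProduct.includeRight : H →ₐ[ℚ] Qbar ⊗[ℚ] H)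
  have hg : ∀ x, g x ∈ (Algebra.ofId ℚ Qbar).range := fun x => by
    rw [AlgHom.mem_range]
    refine (InfiniteGalois.mem_range_algebraMap_iff_fixed (g x)).2 fun σ => ?_
    have : g x = f (1 ⊗ₜ x) := rfl
    rw [this, ← hf]
    simp [galMap]
  let i := AlgEquiv.ofInjectiveField (Algebra.ofId ℚ Qbar)
  refine ⟨(i.symm : _ →ₐ[ℚ] ℚ).comp (g.codRestrict _ hg), ?_⟩
  apply Algebra.TensorProduct.ext
  · ext
  · ext x
    have h1 : algebraMap ℚ Qbar (i.symm (g.codRestrict _ hg x)) = g x :=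
      congrArg Subtype.val (i.apply_symm_apply (g.codRestrict _ hg x))
    simpa [pointBaseChange, g] using h1

/-! ### The character lattice in coordinates -/

/-- The group-like elements that correspond to the standard lattice under a trivialization. -/
def latticeElem {r : ℕ} (e : (Qbar ⊗[ℚ] H) ≃ₐc[Qbar] AddMonoidAlgebra Qbar (Fin r → ℤ))
    (m : Fin r → ℤ) : Qbar ⊗[ℚ] H :=
  e.symm (AddMonoidAlgebra.single m 1)

section
variable {r : ℕ} (e : (Qbar ⊗[ℚ] H) ≃ₐc[Qbar] AddMonoidAlgebra Qbar (Fin r → ℤ))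

lemma latticeElem_injective : Function.Injective (latticeElem e) := fun _ _ h =>
  AddMonoidAlgebra.single_left_injective one_ne_zero (e.symm.injective h)

lemma latticeElem_zero : latticeElem e 0 = 1 := map_one e.symm

lemma latticeElem_add (m m' : Fin r → ℤ) :
    latticeElem e (m + m') = latticeElem e m * latticeElem e m' := by
  simp only [latticeElem, ← map_mul, AddMonoidAlgebra.single_mul_single, mul_one]

lemma isGroupLikeElem_latticeElem (m : Fin r → ℤ) : IsGroupLikeElem Qbar (latticeElem e m) :=
  (AddMonoidAlgebra.isGroupLikeElem_single_one m).map e.symm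

/-- The group-like elements of a group algebra over a field are exactly the group elements. -/
lemma exists_latticeElem_eq {x : Qbar ⊗[ℚ] H} (hx : IsGroupLikeElem Qbar x) :
    ∃ m, latticeElem e m = x := by
  obtain ⟨m, hm⟩ := AddMonoidAlgebra.isGroupLikeElem_iff_mem_range_single_one.1 (hx.map e)
  refine ⟨m, ?_⟩
  change AddMonoidAlgebra.single m 1 = e x at hm
  rw [latticeElem, hm]
  exact e.symm_apply_apply _

/-- The action of a Galois automorphism on the character lattice, in coordinates. -/
def latticeAct (σ : AbsGal) (m : Fin r → ℤ) : Fin r → ℤ :=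
  (exists_latticeElem_eq e (isGroupLikeElem_galMap (isGroupLikeElem_latticeElem e m) σ)).choose

lemma latticeElem_latticeAct (σ : AbsGal) (m : Fin r → ℤ) :
    latticeElem e (latticeAct e σ m) = galMap H σ (latticeElem e m) :=
  (exists_latticeElem_eq e (isGroupLikeElem_galMap (isGroupLikeElem_latticeElem e m) σ)).choose_spec

/-- The Galois representation on the character lattice, in coordinates. -/
def latticeRep : AbsGal →* AddMonoid.End (Fin r → ℤ) where
  toFun σ :=
    { toFun := latticeAct e σ
      map_zero' := latticeElem_injective e <| by
        rw [latticeElem_latticeAct, latticeElem_zero, map_one]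
      map_add' := fun _ _ => latticeElem_injective e <| by
        simp only [latticeElem_latticeAct, latticeElem_add, map_mul] }
  map_one' := by
    ext1 m
    exact latticeElem_injective e ((latticeElem_latticeAct e 1 m).trans (galMap_one _))
  map_mul' σ τ := by
    ext1 m
    refine latticeElem_injective e ((latticeElem_latticeAct e (σ * τ) m).trans ?_)
    rw [galMap_mul, ← latticeElem_latticeAct, ← latticeElem_latticeAct]
    rfl

lemma latticeElem_latticeRep (σ : AbsGal) (m : Fin r → ℤ) :
    latticeElem e (latticeRep e σ m) = galMap H σ (latticeElem e m) :=
  latticeElem_latticeAct e σ m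

/-- The character attached to a point of the lattice. -/
def latticeCharacter (m : Fin r → ℤ) : Character H :=
  (e.symm : AddMonoidAlgebra Qbar (Fin r → ℤ) →ₐc[Qbar] (Qbar ⊗[ℚ] H)).comp
    (AddMonoidAlgebra.mapDomainBialgHom Qbar (zmultiplesHom _ m))

lemma latticeCharacter_T (m : Fin r → ℤ) :
    latticeCharacter e m (LaurentPolynomial.T 1) = latticeElem e m := by
  change e.symm (AddMonoidAlgebra.mapDomainBialgHom Qbar (zmultiplesHom _ m)
    (AddMonoidAlgebra.single 1 1)) = _
  rw [AddMonoidAlgebra.mapDomainBialgHom_single]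
  simp [latticeElem]

/-- Each lattice element is the image of `T` under a character, which `σ` fixes. Hence the
representation factors through `Gal(L/ℚ)`. -/
lemma latticeRep_eq_one_of_mem [IsAlgTorus H] {σ : AbsGal}
    (hσ : σ ∈ (splittingField H).fixingSubgroup) : latticeRep e σ = 1 := by
  ext1 m
  refine latticeElem_injective e ?_
  rw [latticeElem_latticeRep, ← latticeCharacter_T,
    galMap_T (splittingField_fixes H σ hσ (latticeCharacter e m)), latticeCharacter_T]
  rfl

end

/-- A bialgebra morphism out of `Qbar[T, T⁻¹]` is determined by the image of `T`. -/
lemma eq_trivialCharacter_of_T {χ : Character H} (h : χ (LaurentPolynomial.T 1) = 1) :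
    χ = trivialCharacter H := by
  have hT : trivialCharacter H (LaurentPolynomial.T 1) = 1 := by
    change algebraMap Qbar (Qbar ⊗[ℚ] H) (Coalgebra.counit (R := Qbar)
      (AddMonoidAlgebra.single (1 : ℤ) (1 : Qbar))) = 1
    rw [(AddMonoidAlgebra.isGroupLikeElem_single_one (1 : ℤ)).counit_eq_one, map_one]
  exact AddMonoidAlgebra.bialgHom_ext' (MonoidHom.ext_mint (h.trans hT.symm))
    (Subsingleton.elim _ _)

end
end AlgTorus

/-! ### Construction of the rational point -/

theorem theorem1 (H : Type*) [CommRing H] [HopfAlgebra ℚ H] [AlgTorus.IsAlgTorus H]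
    (n : ℕ) (hn : 0 < n) :
    ∃ h : AlgTorus.RationalPoint H,
      (∀ χ : AlgTorus.Character H, χ ≠ AlgTorus.trivialCharacter H →
        ¬ IsIntegral ℤ (AlgTorus.eval χ h)) ∧
      (∀ χ : AlgTorus.Character H,
        ∀ π ∈ AlgTorus.primeDivisors (AlgTorus.splittingField H) n,
          AlgTorus.CongrMod n π (AlgTorus.eval χ h) 1) := by
  open AlgTorus in
  obtain ⟨r, ⟨e⟩⟩ := IsAlgTorus.exists_bialgEquiv (H := H)
  have hGal : IsGalois ℚ (splittingField H) := (isLeast_splittingField H).1.1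
  have hfin : FiniteDimensional ℚ (splittingField H) := by
    convert! (numberField_splittingField (H := H)).to_finiteDimensional
  let res : AbsGal →* (splittingField H ≃ₐ[ℚ] splittingField H) :=
    AlgEquiv.restrictNormalHom (splittingField H)
  have hres : ∀ σ (x : splittingField H), ((res σ x : splittingField H) : Qbar) = σ x :=
    fun σ x => AlgEquiv.restrictNormal_commutes σ (splittingField H) x
  have hsurj : Function.Surjective res := AlgEquiv.restrictNormalHom_surjective Qbar
  -- Passing to units gives a group as target, as lifting along the surjection `res` requires.
  let rep : {g : AbsGal →* (AddMonoid.End (Fin r → ℤ))ˣ // res.ker ≤ g.ker} :=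
    ⟨(latticeRep e).toHomUnits, fun σ hσ => by
      refine Units.ext (latticeRep_eq_one_of_mem e
        ((IntermediateField.mem_fixingSubgroup_iff _ σ).2 fun x hx => ?_))
      rw [← hres σ ⟨x, hx⟩, MonoidHom.mem_ker.1 hσ]
      rfl⟩
  let ρ : (splittingField H ≃ₐ[ℚ] splittingField H) →* AddMonoid.End (Fin r → ℤ) :=
    (Units.coeHom _).comp (res.liftOfSurjective hsurj rep)
  have hρ : ∀ σ, ρ (res σ) = latticeRep e σ := fun σ =>
    congrArg Units.val (res.liftOfRightInverse_comp_apply _ (Function.rightInverse_surjInv hsurj)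
      rep σ)
  let φ : (splittingField H ≃ₐ[ℚ] splittingField H) →* (splittingField H ≃+* splittingField H) :=
    { toFun := fun s => s.toRingEquiv
      map_one' := rfl
      map_mul' := fun _ _ => rfl }
  have hφ : Function.Injective φ := fun s t h => AlgEquiv.ext fun x =>
    congrArg (fun f : splittingField H ≃+* splittingField H => f x) h
  obtain ⟨p, hequiv, hint, hcong⟩ := exists_equivariant_hom_not_isIntegral φ hφ ρ hn.ne'
  let f : (Qbar ⊗[ℚ] H) →ₐ[Qbar] Qbar :=
    (AddMonoidAlgebra.lift Qbar Qbar (Fin r → ℤ)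
      (((splittingField H).val : splittingField H →* Qbar).comp p)).comp
      (e : (Qbar ⊗[ℚ] H) →ₐ[Qbar] AddMonoidAlgebra Qbar (Fin r → ℤ))
  have hf : ∀ m, f (latticeElem e m) = p (.ofAdd m) := fun m => by
    have : f (latticeElem e m) = AddMonoidAlgebra.lift Qbar Qbar (Fin r → ℤ)
      (((splittingField H).val : splittingField H →* Qbar).comp p)
      (e (e.symm (AddMonoidAlgebra.single m 1))) := rfl
    rw [this, e.apply_symm_apply, AddMonoidAlgebra.lift_single, one_smul]
    rfl
  -- By semilinearity it is enough to compare on lattice elements, where this is the equivariance of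
  -- `p`.
  have hfgal : ∀ σ x, f (galMap H σ x) = σ (f x) := fun σ x => by
    obtain ⟨y, rfl⟩ : ∃ y, e.symm y = x := ⟨e x, e.symm_apply_apply x⟩
    induction y using AddMonoidAlgebra.induction_linear with
    | zero => simp
    | add y z hy hz => simp only [map_add, hy, hz]
    | single m c =>
      have : e.symm (AddMonoidAlgebra.single m c) = c • latticeElem e m := by
        rw [latticeElem, ← map_smul, AddMonoidAlgebra.smul_single, smul_eq_mul, mul_one]
      rw [this, galMap_smul, map_smul, map_smul, ← latticeElem_latticeRep, hf, hf, ← hρ,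
        hequiv, smul_eq_mul, smul_eq_mul, map_mul, ← hres]
      rfl
  obtain ⟨h, hh⟩ := exists_pointBaseChange_eq f hfgal
  have heval : ∀ χ : Character H, ∃ m, latticeElem e m = χ (LaurentPolynomial.T 1) ∧
      eval χ h = p (.ofAdd m) := fun χ => by
    obtain ⟨m, hm⟩ := exists_latticeElem_eq e
      ((AddMonoidAlgebra.isGroupLikeElem_single_one (1 : ℤ)).map χ)
    refine ⟨m, hm, Subtype.ext ?_⟩
    change pointBaseChange h (χ (LaurentPolynomial.T 1)) = _
    rw [hh, ← hf, hm]
    rfl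
  refine ⟨h, fun χ hχ => ?_, fun χ π hπ => ?_⟩
  · obtain ⟨m, hm, hev⟩ := heval χ
    rw [hev]
    refine hint m fun h0 => hχ (eq_trivialCharacter_of_T ?_)
    rw [← hm, h0, latticeElem_zero]
  · obtain ⟨m, -, hev⟩ := heval χ
    rw [hev]
    exact hcong m π hπ

end
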